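/- Conventions. A small category $\Lambda$ is regarded as the set of its morphisms (paths), with objects (vertices) $v\in\Lambda^0$ identified with identity morphisms, and with source and range maps $s,r$; $\alpha\beta$ is defined when $s(\alpha)=r(\beta)$. Write $v\Lambda=\{\alpha\in\Lambda: r(\alpha)=v\}$ and $\alpha\Lambda=\{\alpha\beta:\beta\in s(\alpha)\Lambda\}$. $\Lambda$ is a category of paths if $\alpha\beta=\alpha\gamma$ implies $\beta=\gamma$, $\beta\alpha=\gamma\alpha$ implies $\beta=\gamma$, and $\alpha\beta=s(\beta)$ implies $\alpha=\beta=s(\beta)$. It is finitely aligned if for all $\alpha,\beta\in\Lambda$ there is a finite $G\subseteq\Lambda$ with $\alpha\Lambda\cap\beta\Lambda=\bigcup_{\varepsilon\in G}\varepsilon\Lambda$. Paths $\alpha,\beta$ meet if $\alpha\Lambda\cap\beta\Lambda\neq\emptyset$. $\Lambda$ is aperiodic if there are no $\alpha\ne\beta$ in $\Lambda$ with $s(\alpha)=s(\beta)$ and $r(\alpha)=r(\beta)$ such that $\alpha\gamma$ meets $\beta\gamma$ for every $\gamma\in s(\alpha)\Lambda$. The unit space. A zigzag is a tuple $\zeta=(\alpha_1,\beta_1,\dots,\alpha_n,\beta_n)$,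 $n\ge1$, of paths with $r(\alpha_i)=r(\beta_i)$ and $s(\alpha_{i+1})=s(\beta_i)$. Write $s(\zeta)=s(\beta_n)$, and let $A(\zeta)\subseteq s(\zeta)\Lambda$ be the domain of the partial map $\sigma^{\alpha_1}\beta_1\cdots\sigma^{\alpha_n}\beta_n$, where $\beta$ denotes $\gamma\mapsto\beta\gamma$ and $\sigma^\alpha$ denotes $\alpha\gamma\mapsto\gamma$. For $v\in\Lambda^0$ let $\mathcal A_v$ be the ring of subsets of $v\Lambda$ generated by the nonempty sets $A(\zeta)$ with $s(\zeta)=v$, and let $X_v$ be the set of ultrafilters (maximal filters) in $\mathcal A_v$, with the topology generated by the sets $\widehat E=\{x\in X_v:E\in x\}$, $E\in\mathcal A_v$. Put $X=\bigsqcup_{v}X_v$ (disjoint union topology). For $\alpha\in\Lambda$ and $x\in X_{s(\alpha)}$, $\alpha x\in X_{r(\alpha)}$ is the ultrafilter with base $\{\alpha E:E\in x\}$. The groupoid. If $\Lambda$ is finitely aligned, the groupoid $G=G(\Lambda)$ is the set of classes $[\alpha,\beta,x]$ of triples with $s(\alpha)=s(\beta)$ and $x\in X_{s(\alpha)}$,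 where $(\alpha,\beta,x)\sim(\alpha',\beta',x')$ if there are $v\in\Lambda^0$, $z\in X_v$ and $\delta,\delta'\in\Lambda$ with source $v$ such that $x=\delta z$, $x'=\delta'z$, $\alpha\delta=\alpha'\delta'$ and $\beta\delta=\beta'\delta'$. The source of $[\alpha,\beta,x]$ is $\beta x$, its range is $\alpha x$, its inverse is $[\beta,\alpha,x]$, and $[\alpha,\beta,x][\gamma,\delta,y]=[\alpha\xi,\delta\eta,z]$ whenever $x=\xi z$, $y=\eta z$ and $\beta\xi=\gamma\eta$ (such $\xi,\eta,z$ exist if $\beta x=\gamma y$). The unit space is identified with $X$ through $x\mapsto[v,v,x]$, $x\in X_v$. The boundary. A set $C\subseteq v\Lambda$ is directed if $\alpha\Lambda\cap\beta\Lambda\cap C\ne\emptyset$ for all $\alpha,\beta\in C$. A maximal directed set $C\subseteq v\Lambda$ is identified with the ultrafilter $\{E\in\mathcal A_v: C\cap\alpha\Lambda\subseteq E\text{ for some }\alpha\in C\}$. The boundary $\partial\Lambda$ is the closure in $X$ of the set of all maximal directed subsets of the sets $v\Lambda$, $v\in\Lambda^0$. The groupoid $G|_{\partial\Lambda}$ consists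 of the elements of $G$ whose source and range lie in $\partial\Lambda$; its unit space is $\partial\Lambda$ with the subspace topology. It is topologically free if the set of those $x\in\partial\Lambda$ whose isotropy group (the elements with source and range $x$) is trivial is dense in $\partial\Lambda$. Theorem. Let $\Lambda$ be a countable, finitely aligned category of paths. Then $G|_{\partial\Lambda}$ is topologically free if and only if $\Lambda$ is aperiodic. -/

import Mathlib

open CategoryTheory

universe w u

namespace PathCat

/-! Composition is written in Mathlib's order: for paths `α : u ⟶ v` (source `u`, range `v`) and
`β : t ⟶ u`, the concatenation `αβ` of the paper is `β ≫ α : t ⟶ v`. -/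

section Basic

variable (V : Type u) [Category.{w} V]

/-- A category of paths: a small category with left-cancellation, right-cancellation and no
inverses. Vertices are the objects of `V` and paths are its morphisms. -/
class IsCategoryOfPaths : Prop where
  left_cancel : ∀ {t u v : V} (α : u ⟶ v) (β γ : t ⟶ u), β ≫ α = γ ≫ α → β = γ
  right_cancel : ∀ {t u v : V} (α : t ⟶ u) (β γ : u ⟶ v), α ≫ β = α ≫ γ → β = γ
  no_inverses : ∀ {u v : V} (α : v ⟶ u) (β : u ⟶ v), β ≫ α = 𝟙 u →
    ∃ h : u = v, α = eqToHom h.symm ∧ β = eqToHom h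

variable {V}

/-- `VPath v` is the set `vΛ` of all paths with range `v`; `x.1` is the source of `x`. -/
abbrev VPath (v : V) : Type (max u w) := Σ t : V, (t ⟶ v)

/-- The right shift `β ↦ αβ` from `s(α)Λ` to `r(α)Λ`. -/
def cat {u v : V} (α : u ⟶ v) (β : VPath u) : VPath v := ⟨β.1, β.2 ≫ α⟩

/-- `tail α` is the set `αΛ` of all extensions of the path `α`. -/
def tail {v : V} (α : VPath v) : Set (VPath v) := Set.range (cat α.2)

/-- `α` meets `β`: the two paths have a common extension. -/
def Meets {v : V} (α β : VPath v) : Prop := (tail α ∩ tail β).Nonempty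

variable (V) in
/-- Finite alignment: `αΛ ∩ βΛ` is a finite union of sets `εΛ`. (If `r(α) ≠ r(β)`, then the
intersection is empty, so only paths with the same range matter.) -/
class FinitelyAligned : Prop where
  exists_finset : ∀ {v : V} (α β : VPath v), ∃ G : Finset (VPath v),
    tail α ∩ tail β = ⋃ ε ∈ G, tail ε

variable (V) in
/-- A category of paths is aperiodic if there are no `α ≠ β` with the same source and the same
range such that `αγ` meets `βγ` for every `γ ∈ s(α)Λ`. -/
def IsAperiodic : Prop :=
  ¬ ∃ (u v : V) (α β : u ⟶ v), α ≠ β ∧ ∀ γ : VPath u, Meets (cat α γ) (cat β γ)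

/-- Zigzags `(α₁, β₁, …, αₙ, βₙ)`, `n ≥ 1`, with `r(αᵢ) = r(βᵢ)` and `s(αᵢ₊₁) = s(βᵢ)`.
`Zigzag u v` is the type of the zigzags with source `s(βₙ) = u` and range `s(α₁) = v`. -/
inductive Zigzag (u : V) : V → Type (max u w)
  | single {v t : V} (α : v ⟶ t) (β : u ⟶ t) : Zigzag u v
  | cons {v t m : V} (α : v ⟶ t) (β : m ⟶ t) (ζ : Zigzag u m) : Zigzag u v

/-- The graph of the zigzag map `σ^{α₁} β₁ ⋯ σ^{αₙ} βₙ`, a partial map from `uΛ` to `vΛ`: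
`σ^α β` sends `x` to `y` exactly when `βx = αy`. -/
def Zigzag.graph {u : V} : {v : V} → Zigzag u v → VPath u → VPath v → Prop
  | _, .single α β, x, y => cat β x = cat α y
  | _, .cons α β ζ, x, y => ∃ z, ζ.graph x z ∧ cat β z = cat α y

/-- The zigzag set of `ζ`: the domain of the zigzag map. -/
def Zigzag.dom {u v : V} (ζ : Zigzag u v) : Set (VPath u) := {x | ∃ y, ζ.graph x y}

/-- The collection of the nonempty zigzag sets in `vΛ`. -/
def zigzagSets (v : V) : Set (Set (VPath v)) :=
  {E | E.Nonempty ∧ ∃ (t : V) (ζ : Zigzag v t), E = ζ.dom}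

/-- The ring of subsets of `vΛ` generated by the nonempty zigzag sets. -/
def ring (v : V) : Set (Set (VPath v)) :=
  {E | ∀ R : Set (Set (VPath v)), MeasureTheory.IsSetRing R → zigzagSets v ⊆ R → E ∈ R}

/-- `U` is a filter in the ring of sets `A`. -/
structure IsRingFilter {S : Type*} (A U : Set (Set S)) : Prop where
  subset : U ⊆ A
  nonempty : U.Nonempty
  nonempty_of_mem : ∀ E ∈ U, E.Nonempty
  inter_mem : ∀ E ∈ U, ∀ F ∈ U, E ∩ F ∈ U
  mem_of_superset : ∀ E ∈ U, ∀ F ∈ A, E ⊆ F → F ∈ U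

/-- The space `X_v` of the ultrafilters (maximal filters) in the ring of sets at `v`. -/
structure Spec (v : V) : Type (max u w) where
  /-- the members of the ultrafilter -/
  sets : Set (Set (VPath v))
  maximal : Maximal (IsRingFilter (ring v)) sets

/-- The topology of `X_v` is generated by the sets of all ultrafilters that contain `E`, where `E`
runs through the ring. -/
instance (v : V) : TopologicalSpace (Spec v) :=
  TopologicalSpace.generateFrom {W | ∃ E ∈ ring v, W = {x : Spec v | E ∈ x.sets}}

/-! ### The ring of sets is closed under the shift maps -/

theorem ring_isSetRing (v : V) : MeasureTheory.IsSetRing (ring v) where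
  empty_mem := fun _ hR _ => hR.empty_mem
  union_mem := fun _ _ hs ht R hR h => hR.union_mem (hs R hR h) (ht R hR h)
  sdiff_mem := fun _ _ hs ht R hR h => hR.sdiff_mem (hs R hR h) (ht R hR h)

theorem dom_mem_ring {u v : V} (ζ : Zigzag u v) : ζ.dom ∈ ring u := by
  intro R hR h
  rcases Set.eq_empty_or_nonempty ζ.dom with h0 | h0
  · rw [h0]; exact hR.empty_mem
  · exact h ⟨h0, v, ζ, rfl⟩

theorem ring_induction {v : V} {P : Set (VPath v) → Prop} (empty : P ∅)
    (union : ∀ s t, P s → P t → P (s ∪ t)) (diff : ∀ s t, P s → P t → P (s \ t))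
    (dom : ∀ (t : V) (ζ : Zigzag v t), P ζ.dom) {E : Set (VPath v)} (hE : E ∈ ring v) : P E := by
  refine hE {F | P F} ⟨empty, fun s t => union s t, fun s t => diff s t⟩ ?_
  rintro F ⟨-, t, ζ, rfl⟩
  exact dom t ζ

theorem exists_zigzag_comp {u v t : V} (ζ : Zigzag v t) (ξ : Zigzag u v) :
    ∃ η : Zigzag u t, ∀ x y, η.graph x y ↔ ∃ z, ξ.graph x z ∧ ζ.graph z y := by
  induction ζ with
  | single α β => exact ⟨.cons α β ξ, fun x y => by simp only [Zigzag.graph]⟩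
  | cons α β ζ ih =>
    obtain ⟨η, hη⟩ := ih
    refine ⟨.cons α β η, fun x y => ?_⟩
    simp only [Zigzag.graph, hη]
    constructor
    · rintro ⟨z, ⟨z', h1, h2⟩, h3⟩
      exact ⟨z', h1, z, h2, h3⟩
    · rintro ⟨z', h1, z, h2, h3⟩
      exact ⟨z, ⟨z', h1, h2⟩, h3⟩

theorem cat_id {v : V} (x : VPath v) : cat (𝟙 v) x = x := by
  cases x; simp [cat]

theorem cat_comp {t u v : V} (δ : t ⟶ u) (α : u ⟶ v) (x : VPath t) :
    cat (δ ≫ α) x = cat α (cat δ x) := by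
  simp [cat]

theorem preimage_mem_ring {u v : V} (α : u ⟶ v) {E : Set (VPath v)} (hE : E ∈ ring v) :
    cat α ⁻¹' E ∈ ring u := by
  refine ring_induction (P := fun E => cat α ⁻¹' E ∈ ring u) (ring_isSetRing u).empty_mem
    (fun s t hs ht => (ring_isSetRing u).union_mem hs ht)
    (fun s t hs ht => (ring_isSetRing u).sdiff_mem hs ht) ?_ hE
  intro t ζ
  obtain ⟨η, hη⟩ := exists_zigzag_comp ζ (.single (𝟙 v) α)
  have : cat α ⁻¹' ζ.dom = η.dom := by
    ext x
    simp only [Zigzag.dom, Set.mem_preimage, Set.mem_ofPred_eq, hη, Zigzag.graph, cat_id]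
    constructor
    · rintro ⟨y, hy⟩
      exact ⟨y, _, rfl, hy⟩
    · rintro ⟨y, z, rfl, hy⟩
      exact ⟨y, hy⟩
  rw [this]
  exact dom_mem_ring η

theorem cat_mem_dom {u v : V} (ζ : Zigzag u v) {x : VPath u} {y : VPath v} (h : ζ.graph x y)
    {t : V} (γ : t ⟶ x.1) : ∃ γ' : t ⟶ y.1, ζ.graph ⟨t, γ ≫ x.2⟩ ⟨t, γ' ≫ y.2⟩ := by
  induction ζ with
  | single α β =>
    obtain ⟨a, x⟩ := x
    obtain ⟨b, y⟩ := y
    simp only [Zigzag.graph, cat, Sigma.mk.injEq] at h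
    obtain ⟨rfl, h⟩ := h
    have h := eq_of_heq h
    exact ⟨γ, by simp [Zigzag.graph, cat, h]⟩
  | cons α β ζ ih =>
    simp only [Zigzag.graph] at h ⊢
    obtain ⟨z, h1, h2⟩ := h
    obtain ⟨γ1, h3⟩ := ih h1
    obtain ⟨a, z⟩ := z
    obtain ⟨b, y⟩ := y
    simp only [cat, Sigma.mk.injEq] at h2
    obtain ⟨rfl, h⟩ := h2
    have h := eq_of_heq h
    exact ⟨γ1, _, h3, by simp [cat, h]⟩

/-- Every zigzag set contains all the extensions of its elements. -/
theorem tail_subset_dom {u v : V} (ζ : Zigzag u v) {x : VPath u} (h : x ∈ ζ.dom) :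
    tail x ⊆ ζ.dom := by
  rintro _ ⟨γ, rfl⟩
  obtain ⟨y, hy⟩ := h
  obtain ⟨γ', h'⟩ := cat_mem_dom ζ hy γ.2
  exact ⟨_, h'⟩

theorem univ_mem_ring (v : V) : (Set.univ : Set (VPath v)) ∈ ring v := by
  have : (Set.univ : Set (VPath v)) = (Zigzag.single (𝟙 v) (𝟙 v)).dom := by
    ext x
    simp [Zigzag.dom, Zigzag.graph]
  rw [this]
  exact dom_mem_ring _

/-! ### Directed sets of paths and the ultrafilters that they determine -/

/-- A set of paths with range `v` is directed if any two of its elements have a common extension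
in it. -/
def IsDirectedSet {v : V} (C : Set (VPath v)) : Prop :=
  ∀ α ∈ C, ∀ β ∈ C, (tail α ∩ tail β ∩ C).Nonempty

theorem mem_tail_self {v : V} (α : VPath v) : α ∈ tail α :=
  ⟨⟨α.1, 𝟙 _⟩, by cases α; simp [cat]⟩

theorem tail_subset_tail {v : V} {α β : VPath v} (h : β ∈ tail α) : tail β ⊆ tail α := by
  obtain ⟨γ, rfl⟩ := h
  rintro _ ⟨δ, rfl⟩
  exact ⟨⟨δ.1, δ.2 ≫ γ.2⟩, by simp [cat]⟩

theorem isDirectedSet_singleton {v : V} (α : VPath v) : IsDirectedSet {α} := by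
  rintro _ rfl _ rfl
  exact ⟨_, ⟨mem_tail_self _, mem_tail_self _⟩, rfl⟩

/-- The collection `U_C` of the sets `E` in the ring that contain `C ∩ αΛ` for some `α ∈ C`. -/
def directedFilter {v : V} (C : Set (VPath v)) : Set (Set (VPath v)) :=
  {E | E ∈ ring v ∧ ∃ α ∈ C, C ∩ tail α ⊆ E}

theorem directedFilter_dichotomy {v : V} {C : Set (VPath v)} (hne : C.Nonempty)
    (hC : IsDirectedSet C) {E : Set (VPath v)} (hE : E ∈ ring v) :
    (∃ α ∈ C, C ∩ tail α ⊆ E) ∨ (∃ α ∈ C, C ∩ tail α ⊆ Eᶜ) := by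
  have key : ∀ s t : Set (VPath v), (∃ α ∈ C, C ∩ tail α ⊆ s) → (∃ α ∈ C, C ∩ tail α ⊆ t) →
      ∃ α ∈ C, C ∩ tail α ⊆ s ∩ t := by
    rintro s t ⟨α, hα, h1⟩ ⟨β, hβ, h2⟩
    obtain ⟨γ, ⟨h3, h4⟩, h5⟩ := hC α hα β hβ
    exact ⟨γ, h5, fun x hx =>
      ⟨h1 ⟨hx.1, tail_subset_tail h3 hx.2⟩, h2 ⟨hx.1, tail_subset_tail h4 hx.2⟩⟩⟩
  have mono : ∀ s t : Set (VPath v), s ⊆ t → (∃ α ∈ C, C ∩ tail α ⊆ s) →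
      ∃ α ∈ C, C ∩ tail α ⊆ t := fun s t hst ⟨α, hα, h⟩ => ⟨α, hα, h.trans hst⟩
  refine ring_induction (P := fun E => (∃ α ∈ C, C ∩ tail α ⊆ E) ∨ (∃ α ∈ C, C ∩ tail α ⊆ Eᶜ))
    ?_ ?_ ?_ ?_ hE
  · obtain ⟨α, hα⟩ := hne
    exact Or.inr ⟨α, hα, by simp⟩
  · rintro s t (hs | hs) ht
    · exact Or.inl (mono _ _ Set.subset_union_left hs)
    rcases ht with ht | ht
    · exact Or.inl (mono _ _ Set.subset_union_right ht)
    · rw [Set.compl_union]; exact Or.inr (key _ _ hs ht)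
  · rintro s t (hs | hs) ht
    · rcases ht with ht | ht
      · exact Or.inr (mono _ _ (fun x hx hx' => hx'.2 hx) ht)
      · exact Or.inl (key _ _ hs ht)
    · exact Or.inr (mono _ _ (fun x hx hx' => (show x ∉ s from hx) hx'.1) hs)
  · intro t ζ
    by_cases h : ∃ α ∈ C, α ∈ ζ.dom
    · obtain ⟨α, hα, h⟩ := h
      exact Or.inl ⟨α, hα, fun x hx => tail_subset_dom ζ h hx.2⟩
    · obtain ⟨α, hα⟩ := hne
      exact Or.inr ⟨α, hα, fun x hx hx' => h ⟨x, hx.1, hx'⟩⟩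

theorem isRingFilter_directedFilter {v : V} {C : Set (VPath v)} (hne : C.Nonempty)
    (hC : IsDirectedSet C) : IsRingFilter (ring v) (directedFilter C) where
  subset := fun _ h => h.1
  nonempty := by
    obtain ⟨α, hα⟩ := hne
    exact ⟨Set.univ, univ_mem_ring v, α, hα, Set.subset_univ _⟩
  nonempty_of_mem := fun _ ⟨_, α, hα, h⟩ => ⟨α, h ⟨hα, mem_tail_self α⟩⟩
  inter_mem := by
    rintro E ⟨hE, α, hα, h1⟩ F ⟨hF, β, hβ, h2⟩
    obtain ⟨γ, ⟨h3, h4⟩, h5⟩ := hC α hα β hβ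
    exact ⟨(ring_isSetRing v).inter_mem hE hF, γ, h5, fun x hx =>
      ⟨h1 ⟨hx.1, tail_subset_tail h3 hx.2⟩, h2 ⟨hx.1, tail_subset_tail h4 hx.2⟩⟩⟩
  mem_of_superset := fun _ ⟨_, α, hα, h⟩ F hF hEF => ⟨hF, α, hα, h.trans hEF⟩

/-- A filter in a ring of sets is an ultrafilter as soon as each set in the ring belongs to it or
is disjoint from one of its members. -/
theorem maximal_of_dichotomy {S : Type*} {A U : Set (Set S)} (hU : IsRingFilter A U)
    (h : ∀ E ∈ A, E ∈ U ∨ ∃ F ∈ U, E ∩ F = ∅) : Maximal (IsRingFilter A) U := by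
  refine ⟨hU, fun W hW hUW E hE => ?_⟩
  rcases h E (hW.subset hE) with h | ⟨F, hF, hEF⟩
  · exact h
  · have := hW.nonempty_of_mem _ (hW.inter_mem E hE F (hUW hF))
    rw [hEF] at this
    exact absurd this Set.not_nonempty_empty

/-- The ultrafilter `U_C` that is determined by a nonempty directed set `C`. -/
def ofDirected {v : V} (C : Set (VPath v)) (hne : C.Nonempty) (hC : IsDirectedSet C) : Spec v :=
  ⟨directedFilter C, maximal_of_dichotomy (isRingFilter_directedFilter hne hC) (by
    intro E hE
    rcases directedFilter_dichotomy hne hC hE with h | ⟨α, hα, h⟩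
    · exact Or.inl ⟨hE, h⟩
    · refine Or.inr ⟨Set.univ \ E,
        ⟨(ring_isSetRing v).sdiff_mem (univ_mem_ring v) hE, α, hα, ?_⟩, by simp⟩
      rwa [← Set.compl_eq_univ_sdiff])⟩

/-- A maximal directed set of paths is not empty. -/
theorem nonempty_of_maximal {v : V} {C : Set (VPath v)} (hC : Maximal IsDirectedSet C) :
    C.Nonempty := by
  by_contra h
  rw [Set.not_nonempty_iff_eq_empty] at h
  subst h
  exact hC.2 (isDirectedSet_singleton (⟨v, 𝟙 v⟩ : VPath v)) (Set.empty_subset _)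
    (Set.mem_singleton _)

/-! ### Concatenation of a path and an ultrafilter -/

theorem Spec.dichotomy {v : V} (x : Spec v) {E : Set (VPath v)} (hE : E ∈ ring v) :
    E ∈ x.1 ∨ ∃ F ∈ x.1, E ∩ F = ∅ := by
  by_cases h : ∃ F ∈ x.1, E ∩ F = ∅
  · exact Or.inr h
  refine Or.inl ?_
  have h' : ∀ F ∈ x.1, (E ∩ F).Nonempty := fun F hF =>
    Set.nonempty_iff_ne_empty.2 fun h0 => h ⟨F, hF, h0⟩
  have hx := x.2.1
  have hW : IsRingFilter (ring v) {G | G ∈ ring v ∧ ∃ F ∈ x.1, E ∩ F ⊆ G} := by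
    refine ⟨fun G hG => hG.1, ?_, ?_, ?_, ?_⟩
    · obtain ⟨F, hF⟩ := hx.nonempty
      exact ⟨E, hE, F, hF, Set.inter_subset_left⟩
    · rintro G ⟨-, F, hF, hG⟩
      exact (h' F hF).mono hG
    · rintro G ⟨hG, F, hF, h1⟩ G' ⟨hG', F', hF', h2⟩
      exact ⟨(ring_isSetRing v).inter_mem hG hG', _, hx.inter_mem F hF F' hF',
        fun y hy => ⟨h1 ⟨hy.1, hy.2.1⟩, h2 ⟨hy.1, hy.2.2⟩⟩⟩
    · rintro G ⟨-, F, hF, h1⟩ G' hG' h2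
      exact ⟨hG', F, hF, h1.trans h2⟩
  obtain ⟨F, hF⟩ := hx.nonempty
  exact x.2.2 hW (fun G hG => ⟨hx.subset hG, G, hG, Set.inter_subset_right⟩)
    ⟨hE, F, hF, Set.inter_subset_left⟩

theorem Spec.union_mem {v : V} (x : Spec v) {E F : Set (VPath v)} (hE : E ∈ ring v)
    (hF : F ∈ ring v) (h : E ∪ F ∈ x.1) : E ∈ x.1 ∨ F ∈ x.1 := by
  have hx := x.2.1
  rcases x.dichotomy hE with h1 | ⟨G, hG, h1⟩
  · exact Or.inl h1
  refine Or.inr (hx.mem_of_superset _ (hx.inter_mem _ h _ hG) F hF ?_)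
  rintro y ⟨hy | hy, hy'⟩
  · exact absurd (show y ∈ E ∩ G from ⟨hy, hy'⟩) (by simp [h1])
  · exact hy

theorem tail_mem_ring {v : V} (α : VPath v) : tail α ∈ ring v := by
  have : tail α = (Zigzag.single α.2 (𝟙 v)).dom := by
    ext x
    simp only [tail, Zigzag.dom, Zigzag.graph, cat_id, Set.mem_range, Set.mem_ofPred_eq]
    exact exists_congr fun y => eq_comm
  rw [this]
  exact dom_mem_ring _

theorem Spec.ext_ring {v : V} {x y : Spec v} (h : ∀ E ∈ ring v, E ∈ x.1 ↔ E ∈ y.1) : x = y := by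
  have : x.1 = y.1 := by
    ext E
    exact ⟨fun hE => (h E (x.2.1.subset hE)).1 hE, fun hE => (h E (y.2.1.subset hE)).2 hE⟩
  cases x; cases y; cases this; rfl

variable [IsCategoryOfPaths V]

theorem cat_injective {u v : V} (α : u ⟶ v) : Function.Injective (cat α) := by
  rintro ⟨a, x⟩ ⟨b, y⟩ h
  simp only [cat, Sigma.mk.injEq] at h
  obtain ⟨rfl, h⟩ := h
  rw [IsCategoryOfPaths.left_cancel α x y (eq_of_heq h)]

theorem image_mem_ring {u v : V} (α : u ⟶ v) {E : Set (VPath u)} (hE : E ∈ ring u) :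
    cat α '' E ∈ ring v := by
  refine ring_induction (P := fun E => cat α '' E ∈ ring v) ?_ ?_ ?_ ?_ hE
  · rw [Set.image_empty]; exact (ring_isSetRing v).empty_mem
  · intro s t hs ht
    rw [Set.image_union]; exact (ring_isSetRing v).union_mem hs ht
  · intro s t hs ht
    rw [Set.image_sdiff (cat_injective α)]; exact (ring_isSetRing v).sdiff_mem hs ht
  · intro t ζ
    obtain ⟨η, hη⟩ := exists_zigzag_comp ζ (.single α (𝟙 v))
    have : cat α '' ζ.dom = η.dom := by
      ext x
      simp only [Zigzag.dom, Set.mem_image, Set.mem_ofPred_eq, hη, Zigzag.graph, cat_id]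
      constructor
      · rintro ⟨z, ⟨y, hy⟩, rfl⟩
        exact ⟨y, z, rfl, hy⟩
      · rintro ⟨y, z, rfl, hy⟩
        exact ⟨z, ⟨y, hy⟩, rfl⟩
    rw [this]
    exact dom_mem_ring η

/-- The map `x ↦ αx` from `X_{s(α)}` to `X_{r(α)}`: the ultrafilter `αx` has the sets `αE`, where
`E` belongs to the ultrafilter `x`, as a base. -/
def concat {u v : V} (α : u ⟶ v) (x : Spec u) : Spec v :=
  ⟨{F | F ∈ ring v ∧ ∃ E ∈ x.1, cat α '' E ⊆ F}, by
    have hx := x.2.1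
    refine maximal_of_dichotomy ⟨fun F hF => hF.1, ?_, ?_, ?_, ?_⟩ ?_
    · obtain ⟨E, hE⟩ := hx.nonempty
      exact ⟨_, image_mem_ring α (hx.subset hE), E, hE, subset_rfl⟩
    · rintro F ⟨-, E, hE, h⟩
      exact ((hx.nonempty_of_mem E hE).image _).mono h
    · rintro F ⟨hF, E, hE, h⟩ F' ⟨hF', E', hE', h'⟩
      exact ⟨(ring_isSetRing v).inter_mem hF hF', _, hx.inter_mem E hE E' hE',
        Set.subset_inter ((Set.image_mono Set.inter_subset_left).trans h)
          ((Set.image_mono Set.inter_subset_right).trans h')⟩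
    · rintro F ⟨-, E, hE, h⟩ F' hF' h'
      exact ⟨hF', E, hE, h.trans h'⟩
    · intro F hF
      rcases x.dichotomy (preimage_mem_ring α hF) with h | ⟨E, hE, h⟩
      · exact Or.inl ⟨hF, _, h, Set.image_preimage_subset _ _⟩
      · refine Or.inr ⟨_, ⟨image_mem_ring α (hx.subset hE), E, hE, subset_rfl⟩, ?_⟩
        ext y
        simp only [Set.mem_inter_iff, Set.mem_image, Set.mem_empty_iff_false, iff_false]
        rintro ⟨hy, z, hz, rfl⟩
        exact absurd (show z ∈ cat α ⁻¹' F ∩ E from ⟨hy, hz⟩) (by simp [h])⟩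

theorem mem_concat {u v : V} (α : u ⟶ v) (x : Spec u) {F : Set (VPath v)} (hF : F ∈ ring v) :
    F ∈ (concat α x).1 ↔ cat α ⁻¹' F ∈ x.1 := by
  constructor
  · rintro ⟨-, E, hE, h⟩
    exact x.2.1.mem_of_superset E hE _ (preimage_mem_ring α hF) (Set.image_subset_iff.1 h)
  · intro h
    exact ⟨hF, _, h, Set.image_preimage_subset _ _⟩

theorem concat_id {v : V} (x : Spec v) : concat (𝟙 v) x = x := by
  refine Spec.ext_ring fun E hE => ?_
  rw [mem_concat _ _ hE]
  have : cat (𝟙 v) ⁻¹' E = E := by ext y; simp [cat_id]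
  rw [this]

theorem concat_comp {t u v : V} (δ : t ⟶ u) (α : u ⟶ v) (x : Spec t) :
    concat (δ ≫ α) x = concat α (concat δ x) := by
  refine Spec.ext_ring fun E hE => ?_
  rw [mem_concat _ _ hE, mem_concat _ _ hE, mem_concat _ _ (preimage_mem_ring α hE)]
  have : cat (δ ≫ α) ⁻¹' E = cat δ ⁻¹' (cat α ⁻¹' E) := by ext y; simp [cat_comp]
  rw [this]

theorem concat_injective {u v : V} (α : u ⟶ v) : Function.Injective (concat α) := by
  intro x y h
  refine Spec.ext_ring fun E hE => ?_
  have := mem_concat α x (image_mem_ring α hE)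
  rw [h, mem_concat α y (image_mem_ring α hE), Set.preimage_image_eq _ (cat_injective α)] at this
  exact this.symm

theorem exists_concat_eq {u v : V} (α : u ⟶ v) (y : Spec v) (h : tail ⟨u, α⟩ ∈ y.1) :
    ∃ x : Spec u, concat α x = y := by
  have hy := y.2.1
  have himg : ∀ E : Set (VPath v), cat α '' (cat α ⁻¹' E) = E ∩ tail ⟨u, α⟩ := fun E =>
    Set.image_preimage_eq_inter_range
  refine ⟨⟨{E | E ∈ ring u ∧ cat α '' E ∈ y.1},
    maximal_of_dichotomy ⟨fun E hE => hE.1, ?_, ?_, ?_, ?_⟩ ?_⟩, ?_⟩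
  · refine ⟨Set.univ, univ_mem_ring u, ?_⟩
    rw [Set.image_univ]; exact h
  · rintro E ⟨-, hE⟩
    exact (hy.nonempty_of_mem _ hE).of_image
  · rintro E ⟨hE, hE'⟩ F ⟨hF, hF'⟩
    refine ⟨(ring_isSetRing u).inter_mem hE hF, ?_⟩
    rw [Set.image_inter (cat_injective α)]
    exact hy.inter_mem _ hE' _ hF'
  · rintro E ⟨-, hE⟩ F hF hEF
    exact ⟨hF, hy.mem_of_superset _ hE _ (image_mem_ring α hF) (Set.image_mono hEF)⟩
  · intro E hE
    rcases y.dichotomy (image_mem_ring α hE) with h1 | ⟨F, hF, h1⟩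
    · exact Or.inl ⟨hE, h1⟩
    · refine Or.inr ⟨cat α ⁻¹' F, ⟨preimage_mem_ring α (hy.subset hF), ?_⟩, ?_⟩
      · rw [himg]; exact hy.inter_mem _ hF _ h
      · ext z
        simp only [Set.mem_inter_iff, Set.mem_preimage, Set.mem_empty_iff_false, iff_false]
        rintro ⟨hz, hz'⟩
        exact absurd (show cat α z ∈ cat α '' E ∩ F from ⟨⟨z, hz, rfl⟩, hz'⟩) (by simp [h1])
  · refine Spec.ext_ring fun E hE => ?_
    rw [mem_concat _ _ hE]
    simp only [Set.mem_ofPred_eq, himg]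
    constructor
    · rintro ⟨-, h1⟩
      exact hy.mem_of_superset _ h1 _ hE Set.inter_subset_left
    · intro h1
      exact ⟨preimage_mem_ring α hE, hy.inter_mem _ h1 _ h⟩

/-- Common tails: if `αx = βy`, then `x = δz`, `y = εz` and `αδ = βε` for some `δ`, `ε` and `z`. -/
theorem exists_common_tail [FinitelyAligned V] {a b v : V} (α : a ⟶ v) (β : b ⟶ v) (x : Spec a)
    (y : Spec b) (h : concat α x = concat β y) :
    ∃ (t : V) (δ : t ⟶ a) (ε : t ⟶ b) (z : Spec t),
      concat δ z = x ∧ concat ε z = y ∧ δ ≫ α = ε ≫ β := by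
  have hmem : ∀ {c : V} (γ : c ⟶ v) (q : Spec c), tail ⟨c, γ⟩ ∈ (concat γ q).1 := by
    intro c γ q
    rw [mem_concat _ _ (tail_mem_ring _)]
    have : cat γ ⁻¹' tail ⟨c, γ⟩ = Set.univ := by
      ext p
      simp [tail]
    rw [this]
    obtain ⟨E, hE⟩ := q.2.1.nonempty
    exact q.2.1.mem_of_superset E hE _ (univ_mem_ring c) (Set.subset_univ _)
  set w := concat α x with hw
  have h1 : tail ⟨a, α⟩ ∈ w.1 := hmem α x
  have h2 : tail ⟨b, β⟩ ∈ w.1 := by rw [h]; exact hmem β y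
  have h3 := w.2.1.inter_mem _ h1 _ h2
  obtain ⟨G, hG⟩ := FinitelyAligned.exists_finset (V := V) ⟨a, α⟩ ⟨b, β⟩
  have key : ∀ H : Finset (VPath v), (⋃ ε ∈ H, tail ε) ∈ ring v ∧
      ((⋃ ε ∈ H, tail ε) ∈ w.1 → ∃ ε ∈ H, tail ε ∈ w.1) := by
    classical
    intro H
    induction H using Finset.induction_on with
    | empty =>
      refine ⟨by simpa using (ring_isSetRing v).empty_mem, fun h0 => ?_⟩
      have := w.2.1.nonempty_of_mem _ h0
      simp at this
    | insert ε H _ ih =>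
      rw [Finset.set_biUnion_insert]
      refine ⟨(ring_isSetRing v).union_mem (tail_mem_ring ε) ih.1, fun h0 => ?_⟩
      rcases w.union_mem (tail_mem_ring ε) ih.1 h0 with h4 | h4
      · exact ⟨ε, Finset.mem_insert_self _ _, h4⟩
      · obtain ⟨η, hη, h5⟩ := ih.2 h4
        exact ⟨η, Finset.mem_insert_of_mem hη, h5⟩
  rw [hG] at h3
  obtain ⟨ε, hε, h4⟩ := (key G).2 h3
  have h5 : ε ∈ tail ⟨a, α⟩ ∩ tail ⟨b, β⟩ := by
    rw [hG]
    exact Set.mem_biUnion hε (mem_tail_self ε)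
  obtain ⟨⟨⟨c, δ⟩, h6⟩, ⟨⟨d, δ'⟩, h7⟩⟩ := h5
  obtain ⟨e, ε⟩ := ε
  simp only [cat, Sigma.mk.injEq] at h6 h7
  obtain ⟨rfl, h6⟩ := h6
  obtain ⟨rfl, h7⟩ := h7
  have h6 := eq_of_heq h6
  have h7 := eq_of_heq h7
  obtain ⟨z, hz⟩ := exists_concat_eq ε w h4
  refine ⟨_, δ, δ', z, ?_, ?_, h6.trans h7.symm⟩
  · apply concat_injective α
    rw [← concat_comp, h6, hz]
  · apply concat_injective β
    rw [← concat_comp, h7, hz, h]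

end Basic

/-! ### The groupoid -/

section Groupoid

variable (V : Type u) [Category.{w} V]

/-- The disjoint union `X` of the spaces `X_v`, with the disjoint union topology. It is the unit
space of the groupoid below. -/
abbrev UnitSpace : Type (max u w) := Σ v : V, Spec v

variable {V} [IsCategoryOfPaths V]

/-- A triple `(α, β, z)` with `s(α) = s(β)`, `z ∈ X_{s(α)}`, source `βz = x` and range `αz = y`. -/
structure Triple (x y : UnitSpace V) where
  /-- the common source of the two paths -/
  vertex : V
  /-- the path `α` -/
  fst : vertex ⟶ y.1
  /-- the path `β` -/
  snd : vertex ⟶ x.1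
  /-- the point `z` -/
  pt : Spec vertex
  concat_fst : concat fst pt = y.2
  concat_snd : concat snd pt = x.2

/-- `(α, β, z) ∼ (α', β', z')` if there are `δ`, `δ'` and `q` with `z = δq`, `z' = δ'q`,
`αδ = α'δ'` and `βδ = β'δ'`. -/
def Triple.Rel {x y : UnitSpace V} (p p' : Triple x y) : Prop :=
  ∃ (t : V) (δ : t ⟶ p.vertex) (δ' : t ⟶ p'.vertex) (q : Spec t),
    concat δ q = p.pt ∧ concat δ' q = p'.pt ∧
      δ ≫ p.fst = δ' ≫ p'.fst ∧ δ ≫ p.snd = δ' ≫ p'.snd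

theorem Triple.rel_of_eq {x y : UnitSpace V} (p p' : Triple x y) (δ : p.vertex ⟶ p'.vertex)
    (h1 : concat δ p.pt = p'.pt) (h2 : p.fst = δ ≫ p'.fst) (h3 : p.snd = δ ≫ p'.snd) :
    Triple.Rel p p' :=
  ⟨_, 𝟙 _, δ, p.pt, concat_id _, h1, by simpa using h2, by simpa using h3⟩

variable [FinitelyAligned V]

theorem Triple.rel_equivalence (x y : UnitSpace V) :
    Equivalence (Triple.Rel : Triple x y → Triple x y → Prop) where
  refl p := ⟨_, 𝟙 _, 𝟙 _, p.pt, concat_id _, concat_id _, rfl, rfl⟩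
  symm := fun ⟨t, δ, δ', q, h1, h2, h3, h4⟩ => ⟨t, δ', δ, q, h2, h1, h3.symm, h4.symm⟩
  trans := by
    rintro p p' p'' ⟨t, δ, δ', q, h1, h2, h3, h4⟩ ⟨s, ε, ε', r, k1, k2, k3, k4⟩
    obtain ⟨m, a, b, z, l1, l2, l3⟩ := exists_common_tail δ' ε q r (h2.trans k1.symm)
    refine ⟨m, a ≫ δ, b ≫ ε', z, ?_, ?_, ?_, ?_⟩
    · rw [concat_comp, l1, h1]
    · rw [concat_comp, l2, k2]
    · rw [Category.assoc, h3, ← Category.assoc, l3, Category.assoc, k3, Category.assoc]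
    · rw [Category.assoc, h4, ← Category.assoc, l3, Category.assoc, k4, Category.assoc]

instance Triple.setoid (x y : UnitSpace V) : Setoid (Triple x y) :=
  ⟨Triple.Rel, Triple.rel_equivalence x y⟩

/-- The arrows of the groupoid with source `x` and range `y`: classes `[α, β, z]` with `βz = x` and
`αz = y`. -/
def Arrow (x y : UnitSpace V) : Type (max u w) := Quotient (Triple.setoid x y)

/-- The triple `(αξ, δη, z)`, given triples `(α, β, p)` and `(γ, δ, q)` and a common tail
`p = ξz`, `q = ηz` with `βξ = γη`. -/
def Triple.compOf {x y y' : UnitSpace V} (g : Triple y y') (f : Triple x y) {t : V}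
    (ξ : t ⟶ g.vertex) (η : t ⟶ f.vertex) (z : Spec t) (h1 : concat ξ z = g.pt)
    (h2 : concat η z = f.pt) : Triple x y' where
  vertex := t
  fst := ξ ≫ g.fst
  snd := η ≫ f.snd
  pt := z
  concat_fst := by rw [concat_comp, h1, g.concat_fst]
  concat_snd := by rw [concat_comp, h2, f.concat_snd]

theorem Triple.compOf_rel {x y y' : UnitSpace V} {g g' : Triple y y'} {f f' : Triple x y}
    (hg : Triple.Rel g g') (hf : Triple.Rel f f')
    {t : V} {ξ : t ⟶ g.vertex} {η : t ⟶ f.vertex} {z : Spec t} (h1 : concat ξ z = g.pt)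
    (h2 : concat η z = f.pt) (h3 : ξ ≫ g.snd = η ≫ f.fst)
    {t' : V} {ξ' : t' ⟶ g'.vertex} {η' : t' ⟶ f'.vertex} {z' : Spec t'}
    (h1' : concat ξ' z' = g'.pt) (h2' : concat η' z' = f'.pt) (h3' : ξ' ≫ g'.snd = η' ≫ f'.fst) :
    Triple.Rel (g.compOf f ξ η z h1 h2) (g'.compOf f' ξ' η' z' h1' h2') := by
  obtain ⟨a, δ, δ', q, k1, k2, k3, k4⟩ := hg
  obtain ⟨b, ε, ε', r, l1, l2, l3, l4⟩ := hf
  -- a common tail of `z` and `q` over `g`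
  obtain ⟨c, i, j, m, m1, m2, m3⟩ := exists_common_tail ξ δ z q (h1.trans k1.symm)
  -- a common tail of that and `z'` over `g'`
  obtain ⟨d, i', j', n, n1, n2, n3⟩ := exists_common_tail (j ≫ δ') ξ' m z'
    (by rw [concat_comp, m2, k2, h1'])
  -- a common tail with `r` over `f`
  obtain ⟨e, i'', j'', o, o1, o2, o3⟩ := exists_common_tail (i' ≫ i ≫ η) ε n r
    (by rw [concat_comp, concat_comp, n1, m1, h2, l1])
  have hξ : (i'' ≫ i' ≫ i) ≫ ξ ≫ g.fst = (i'' ≫ j') ≫ ξ' ≫ g'.fst := by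
    calc (i'' ≫ i' ≫ i) ≫ ξ ≫ g.fst = i'' ≫ i' ≫ (i ≫ ξ) ≫ g.fst := by simp
      _ = i'' ≫ i' ≫ j ≫ (δ ≫ g.fst) := by rw [m3]; simp
      _ = i'' ≫ (i' ≫ j ≫ δ') ≫ g'.fst := by rw [k3]; simp
      _ = _ := by rw [n3]; simp
  have hξ' : (i'' ≫ i' ≫ i) ≫ ξ ≫ g.snd = (i'' ≫ j') ≫ ξ' ≫ g'.snd := by
    calc (i'' ≫ i' ≫ i) ≫ ξ ≫ g.snd = i'' ≫ i' ≫ (i ≫ ξ) ≫ g.snd := by simp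
      _ = i'' ≫ i' ≫ j ≫ (δ ≫ g.snd) := by rw [m3]; simp
      _ = i'' ≫ (i' ≫ j ≫ δ') ≫ g'.snd := by rw [k4]; simp
      _ = _ := by rw [n3]; simp
  have hη : (i'' ≫ i' ≫ i) ≫ η = j'' ≫ ε := by simpa using o3
  have hη' : j'' ≫ ε' = (i'' ≫ j') ≫ η' := by
    apply IsCategoryOfPaths.left_cancel f'.fst
    calc (j'' ≫ ε') ≫ f'.fst = (j'' ≫ ε) ≫ f.fst := by
          rw [Category.assoc, ← l3, Category.assoc]
      _ = (i'' ≫ i' ≫ i) ≫ ξ ≫ g.snd := by rw [← hη, Category.assoc, h3]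
      _ = ((i'' ≫ j') ≫ η') ≫ f'.fst := by simp only [hξ', h3', Category.assoc]
  refine ⟨e, i'' ≫ i' ≫ i, i'' ≫ j', o, ?_, ?_, hξ, ?_⟩
  · show concat (i'' ≫ i' ≫ i) o = z
    rw [concat_comp, concat_comp, o1, n1, m1]
  · show concat (i'' ≫ j') o = z'
    rw [concat_comp, o1, n2]
  · show (i'' ≫ i' ≫ i) ≫ η ≫ f.snd = (i'' ≫ j') ≫ η' ≫ f'.snd
    rw [← Category.assoc, hη, Category.assoc, l4, ← Category.assoc, hη', Category.assoc]

theorem Triple.exists_comp {x y y' : UnitSpace V} (g : Triple y y') (f : Triple x y) :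
    ∃ (t : V) (ξ : t ⟶ g.vertex) (η : t ⟶ f.vertex) (z : Spec t),
      concat ξ z = g.pt ∧ concat η z = f.pt ∧ ξ ≫ g.snd = η ≫ f.fst :=
  exists_common_tail g.snd f.fst g.pt f.pt (g.concat_snd.trans f.concat_fst.symm)

/-- A triple that represents the product `[α, β, p] [γ, δ, q] = [αξ, δη, z]`, where
`p = ξz`, `q = ηz` and `βξ = γη`. -/
noncomputable def Triple.comp {x y y' : UnitSpace V} (g : Triple y y') (f : Triple x y) :
    Triple x y' :=
  g.compOf f _ _ _ (Triple.exists_comp g f).choose_spec.choose_spec.choose_spec.choose_spec.1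
    (Triple.exists_comp g f).choose_spec.choose_spec.choose_spec.choose_spec.2.1

theorem Triple.comp_rel {x y y' : UnitSpace V} (g : Triple y y') (f : Triple x y)
    {t : V} {ξ : t ⟶ g.vertex} {η : t ⟶ f.vertex} {z : Spec t}
    (h1 : concat ξ z = g.pt) (h2 : concat η z = f.pt) (h3 : ξ ≫ g.snd = η ≫ f.fst) :
    Triple.Rel (g.comp f) (g.compOf f ξ η z h1 h2) :=
  Triple.compOf_rel ((Triple.rel_equivalence _ _).refl g) ((Triple.rel_equivalence _ _).refl f)
    _ _ (Triple.exists_comp g f).choose_spec.choose_spec.choose_spec.choose_spec.2.2 h1 h2 h3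

theorem Triple.comp_congr {x y y' : UnitSpace V} {g g' : Triple y y'} {f f' : Triple x y}
    (hg : Triple.Rel g g') (hf : Triple.Rel f f') : Triple.Rel (g.comp f) (g'.comp f') :=
  Triple.compOf_rel hg hf
    _ _ (Triple.exists_comp g f).choose_spec.choose_spec.choose_spec.choose_spec.2.2
    _ _ (Triple.exists_comp g' f').choose_spec.choose_spec.choose_spec.choose_spec.2.2

/-- The triple `(r(x), r(x), x)`, which represents the unit at `x`. -/
def Triple.unit (x : UnitSpace V) : Triple x x :=
  ⟨x.1, 𝟙 _, 𝟙 _, x.2, concat_id _, concat_id _⟩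

/-- The triple `(β, α, z)`, which represents the inverse of `[α, β, z]`. -/
def Triple.inv {x y : UnitSpace V} (p : Triple x y) : Triple y x :=
  ⟨p.vertex, p.snd, p.fst, p.pt, p.concat_snd, p.concat_fst⟩

/-- The groupoid of `V`. Its objects are the points of the unit space. The composite `f ≫ g` of
arrows `f : x ⟶ y` and `g : y ⟶ y'` is the product `g f` of the paper. -/
noncomputable instance : Groupoid (UnitSpace V) where
  Hom x y := Arrow x y
  id x := Quotient.mk _ (Triple.unit x)
  comp f g := Quotient.map₂ (fun f g => Triple.comp g f)
    (fun _ _ hf _ _ hg => Triple.comp_congr hg hf) f g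
  id_comp f := by
    induction f using Quotient.inductionOn with | _ f
    refine Quotient.sound ((Triple.rel_equivalence _ _).trans
      (Triple.comp_rel f (Triple.unit _) (ξ := 𝟙 _) (η := f.snd) (z := f.pt)
        (concat_id _) f.concat_snd (by simp [Triple.unit])) ?_)
    exact Triple.rel_of_eq _ _ (𝟙 _) (concat_id _) rfl (by simp [Triple.compOf, Triple.unit])
  comp_id f := by
    induction f using Quotient.inductionOn with | _ f
    refine Quotient.sound ((Triple.rel_equivalence _ _).trans
      (Triple.comp_rel (Triple.unit _) f (ξ := f.fst) (η := 𝟙 _) (z := f.pt)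
        f.concat_fst (concat_id _) (by simp [Triple.unit])) ?_)
    exact Triple.rel_of_eq _ _ (𝟙 _) (concat_id _) (by simp [Triple.compOf, Triple.unit]) rfl
  assoc f g h := by
    induction f using Quotient.inductionOn with | _ f
    induction g using Quotient.inductionOn with | _ g
    induction h using Quotient.inductionOn with | _ h
    have e := fun a b => Triple.rel_equivalence (V := V) a b
    refine Quotient.sound ?_
    obtain ⟨t, ξ, η, z, h1, h2, h3⟩ := Triple.exists_comp g f
    obtain ⟨t', ξ', η', z', h1', h2', h3'⟩ := Triple.exists_comp h g
    obtain ⟨m, a, b, q, k1, k2, k3⟩ := exists_common_tail ξ η' z z' (h1.trans h2'.symm)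
    have A : Triple.Rel (h.comp (g.comp f))
        (h.compOf (g.compOf f ξ η z h1 h2) (b ≫ ξ') a q (by rw [concat_comp, k2, h1']) k1) :=
      (e _ _).trans (Triple.comp_congr ((e _ _).refl h) (Triple.comp_rel g f h1 h2 h3))
        (Triple.comp_rel _ _ _ _ (by
          simp only [Triple.compOf, Category.assoc]
          rw [h3', ← Category.assoc, ← k3, Category.assoc]))
    have B : Triple.Rel ((h.comp g).comp f)
        ((h.compOf g ξ' η' z' h1' h2').compOf f b (a ≫ η) q k2 (by rw [concat_comp, k1, h2])) :=
      (e _ _).trans (Triple.comp_congr (Triple.comp_rel h g h1' h2' h3') ((e _ _).refl f))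
        (Triple.comp_rel _ _ _ _ (by
          simp only [Triple.compOf, Category.assoc]
          rw [← h3, ← Category.assoc, ← k3, Category.assoc]))
    refine (e _ _).trans A ((e _ _).trans ?_ ((e _ _).symm B))
    exact Triple.rel_of_eq _ _ (𝟙 _) (concat_id _) (by simp [Triple.compOf])
      (by simp [Triple.compOf])
  inv f := Quotient.map Triple.inv
    (by
      rintro a b ⟨t, δ, δ', q, h1, h2, h3, h4⟩
      exact ⟨t, δ, δ', q, h1, h2, h4, h3⟩) f
  inv_comp f := by
    induction f using Quotient.inductionOn with | _ f
    refine Quotient.sound ((Triple.rel_equivalence _ _).trans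
      (Triple.comp_rel f (Triple.inv f) (ξ := 𝟙 _) (η := 𝟙 _) (z := f.pt)
        (concat_id _) (concat_id _) (by simp [Triple.inv])) ?_)
    exact Triple.rel_of_eq _ _ f.fst f.concat_fst (by simp [Triple.compOf, Triple.unit])
      (by simp [Triple.compOf, Triple.unit, Triple.inv])
  comp_inv f := by
    induction f using Quotient.inductionOn with | _ f
    refine Quotient.sound ((Triple.rel_equivalence _ _).trans
      (Triple.comp_rel (Triple.inv f) f (ξ := 𝟙 _) (η := 𝟙 _) (z := f.pt)
        (concat_id _) (concat_id _) (by simp [Triple.inv])) ?_)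
    refine Triple.rel_of_eq _ _ f.snd f.concat_snd (by simp [Triple.compOf, Triple.unit, Triple.inv])
      ?_
    show 𝟙 f.vertex ≫ f.snd = f.snd ≫ 𝟙 _
    simp

end Groupoid

/-! ### The boundary -/

section Boundary

variable (V : Type u) [Category.{w} V]

/-- The points of the unit space that come from maximal directed sets of paths. -/
def maximalPoints : Set (UnitSpace V) :=
  {x | ∃ (v : V) (C : Set (VPath v)) (hC : Maximal IsDirectedSet C),
    x = ⟨v, ofDirected C (nonempty_of_maximal hC) hC.1⟩}

/-- The boundary `∂Λ`: the closure of the set of maximal directed sets in the unit space. -/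
structure Boundary : Type (max u w) where
  /-- the point of the unit space -/
  pt : UnitSpace V
  mem : pt ∈ closure (maximalPoints V)

/-- The boundary has the topology of a subspace of the unit space. -/
instance : TopologicalSpace (Boundary V) :=
  TopologicalSpace.induced Boundary.pt inferInstance

variable {V} in
/-- The restriction of the groupoid to the boundary: all arrows with source and range in it. -/
noncomputable instance [IsCategoryOfPaths V] [FinitelyAligned V] : Groupoid (Boundary V) where
  Hom x y := x.pt ⟶ y.pt
  id x := 𝟙 x.pt
  comp {x y z} f g := CategoryStruct.comp (X := x.pt) (Y := y.pt) (Z := z.pt) f g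
  id_comp {x y} f := Category.id_comp (X := x.pt) (Y := y.pt) f
  comp_id {x y} f := Category.comp_id (X := x.pt) (Y := y.pt) f
  assoc {x y z t} f g h := Category.assoc (W := x.pt) (X := y.pt) (Y := z.pt) (Z := t.pt) f g h
  inv {x y} f := Groupoid.inv (X := x.pt) (Y := y.pt) f
  inv_comp {x y} f := Groupoid.inv_comp (X := x.pt) (Y := y.pt) f
  comp_inv {x y} f := Groupoid.comp_inv (X := x.pt) (Y := y.pt) f

end Boundary

/-- A groupoid `G`, whose unit space carries a topology, is topologically free if the units with
trivial isotropy group are dense in the unit space. -/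
def TopologicallyFree (G : Type*) [TopologicalSpace G] [Groupoid G] : Prop :=
  Dense {x : G | ∀ g : x ⟶ x, g = 𝟙 x}

end PathCat

/-! Both directions rest on one fact, `exists_tail_subset`: if `C` is a maximal directed set, each
member of the ultrafilter `U_C` contains a whole tail `γΛ` with `γ ∈ C`, not only the part of it
that lies in `C`. Finite alignment gives this. It makes every zigzag set a finite union of tails,
and it makes every path outside `C` fail to meet some element of `C`. As maximal directed sets are
dense in the boundary, every nonempty basic open subset of the boundary is then controlled by the
extensions of a single path.

If `α ≠ β` violate aperiodicity, then `αz = βz` whenever `αz` is a boundary point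
(`concat_eq_of_forall_meets`): otherwise disjoint sets separate `αz` from `βz`, and a tail `γ₀Λ` is
carried by `α` into one and by `β` into the other, although `αγ₀` meets `βγ₀`. Hence `[α, β, z]` is
isotropy at `αz`. It is not a unit, by right cancellation, so the nonempty open set of boundary
points containing `αΛ` has no point with trivial isotropy.

Conversely, isotropy at `x` consists of classes `[α, β, z]` with `αz = βz = x`, so it is enough to
find, inside any basic open set, a point at which this forces `α = β`. Countability permits a
diagonal argument: starting from any path, one extends it step by step, and the `n`-th step uses
aperiodicity to exclude the `n`-th pair `(α, β)` (`IsAperiodic.exists_mem_tail`). A maximal directed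
set that contains the whole sequence is the desired point (`IsAperiodic.exists_maximal`). -/

namespace PathCat

/-! ### Tails, maximal directed sets and basic open sets -/

section Paths

variable {V : Type u} [Category.{w} V]

theorem tail_cat {u v : V} (α : u ⟶ v) (γ : VPath u) : tail (cat α γ) = cat α '' tail γ := by
  ext x
  simp only [tail, ← Set.range_comp]
  constructor
  · rintro ⟨δ, rfl⟩
    exact ⟨δ, (cat_comp _ _ _).symm⟩
  · rintro ⟨δ, rfl⟩
    exact ⟨δ, cat_comp _ _ _⟩

theorem cat_mem_tail {u v : V} (α : u ⟶ v) (γ : VPath u) : cat α γ ∈ tail ⟨u, α⟩ :=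
  ⟨γ, rfl⟩

theorem exists_maximal_directed {v : V} {C : Set (VPath v)} (hC : IsDirectedSet C) :
    ∃ D, C ⊆ D ∧ Maximal IsDirectedSet D := by
  refine zorn_subset_nonempty {D : Set (VPath v) | IsDirectedSet D} ?_ C hC
  rintro c hc hchain ⟨D₀, hD₀⟩
  refine ⟨⋃₀ c, ?_, fun s hs => Set.subset_sUnion_of_mem hs⟩
  rintro α ⟨D, hD, hα⟩ β ⟨D', hD', hβ⟩
  rcases hchain.total hD hD' with h | h
  · obtain ⟨γ, h1, h2⟩ := hc hD' α (h hα) β hβ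
    exact ⟨γ, h1, D', hD', h2⟩
  · obtain ⟨γ, h1, h2⟩ := hc hD α hα β (h hβ)
    exact ⟨γ, h1, D, hD, h2⟩

/-- The generating sets of the topology already form a base, because ultrafilters are closed under
intersections and under supersets in the ring. -/
theorem Spec.exists_mem_sets_subset_of_isOpen {v : V} {W : Set (Spec v)} (hW : IsOpen W)
    {x : Spec v} (hx : x ∈ W) : ∃ E ∈ x.sets, ∀ y : Spec v, E ∈ y.sets → y ∈ W := by
  induction hW with
  | basic s hs =>
    obtain ⟨E, -, rfl⟩ := hs
    exact ⟨E, hx, fun y hy => hy⟩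
  | univ =>
    obtain ⟨E, hE⟩ := x.maximal.1.nonempty
    exact ⟨E, hE, fun _ _ => trivial⟩
  | inter s t hs ht ihs iht =>
    obtain ⟨E, hE, h1⟩ := ihs hx.1
    obtain ⟨F, hF, h2⟩ := iht hx.2
    refine ⟨E ∩ F, x.maximal.1.inter_mem E hE F hF, fun y hy => ⟨h1 y ?_, h2 y ?_⟩⟩
    · exact y.maximal.1.mem_of_superset _ hy E (x.maximal.1.subset hE) Set.inter_subset_left
    · exact y.maximal.1.mem_of_superset _ hy F (x.maximal.1.subset hF) Set.inter_subset_right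
  | sUnion S hS ih =>
    obtain ⟨s, hs, hxs⟩ := hx
    obtain ⟨E, hE, h1⟩ := ih s hs hxs
    exact ⟨E, hE, fun y hy => ⟨s, hs, h1 y hy⟩⟩

theorem isOpen_setOf_mem_sets {v : V} {E : Set (VPath v)} (hE : E ∈ ring v) :
    IsOpen {x : Spec v | E ∈ x.sets} :=
  TopologicalSpace.isOpen_generateFrom_of_mem ⟨E, hE, rfl⟩

theorem exists_maximal_of_mem_closure {v : V} {x : Spec v}
    (hx : (⟨v, x⟩ : UnitSpace V) ∈ closure (maximalPoints V)) {E : Set (VPath v)}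
    (hE : E ∈ x.sets) :
    ∃ (C : Set (VPath v)) (_ : Maximal IsDirectedSet C), E ∈ directedFilter C := by
  obtain ⟨_, ⟨y, hy, rfl⟩, w, C, hC, h⟩ := mem_closure_iff.1 hx
    (Sigma.mk v '' {y : Spec v | E ∈ y.sets})
    (isOpenMap_sigmaMk _ (isOpen_setOf_mem_sets (x.maximal.1.subset hE))) ⟨x, hE, rfl⟩
  obtain ⟨rfl, h⟩ := Sigma.mk.inj_iff.1 h
  obtain rfl := eq_of_heq h
  exact ⟨C, hC, hy⟩

/-! ### Excluding coincidences `αz = βz` by aperiodicity -/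

theorem tail_mem_concat {u v : V} [IsCategoryOfPaths V] (α : u ⟶ v) {γ : VPath u} {z : Spec u}
    (h : tail γ ∈ z.sets) : tail (cat α γ) ∈ (concat α z).sets :=
  ⟨tail_mem_ring _, tail γ, h, (tail_cat α γ).ge⟩

theorem Spec.meets_of_mem {v : V} (x : Spec v) {α β : VPath v} (hα : tail α ∈ x.sets)
    (hβ : tail β ∈ x.sets) : Meets α β :=
  x.maximal.1.nonempty_of_mem _ (x.maximal.1.inter_mem _ hα _ hβ)

/-- One step of the diagonal argument: extend `γ` so that no ultrafilter containing the new tail has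
the form `αz = βz`. The pair enters as `a`, `b` with equations, so that all pairs of paths can be
enumerated together; pairs with different sources or with equal paths impose nothing. -/
theorem IsAperiodic.exists_mem_tail [IsCategoryOfPaths V] (h : IsAperiodic V) {v : V} (γ a b : VPath v) :
    ∃ γ' ∈ tail γ, ∀ {u : V} {α β : u ⟶ v} {z : Spec u}, a = ⟨u, α⟩ → b = ⟨u, β⟩ → α ≠ β →
      concat α z = concat β z → tail γ' ∉ (concat α z).sets := by
  by_cases hab : ∃ (u : V) (α β : u ⟶ v), a = ⟨u, α⟩ ∧ b = ⟨u, β⟩ ∧ α ≠ β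
  swap
  · exact ⟨γ, mem_tail_self γ, fun ha hb hne => absurd ⟨_, _, _, ha, hb, hne⟩ hab⟩
  obtain ⟨u, α, β, rfl, rfl, hne⟩ := hab
  by_cases hm : Meets γ ⟨u, α⟩
  · obtain ⟨_, hx, ⟨γ₀, rfl⟩⟩ := hm
    -- `αγ₀` extends `γ`, and `αγ₀ ≠ βγ₀` by right cancellation, so aperiodicity applies to this
    -- pair. The extension sought is `αγ₀μ`.
    obtain ⟨μ, hμ⟩ : ∃ μ, ¬ Meets (cat (γ₀.2 ≫ α) μ) (cat (γ₀.2 ≫ β) μ) := by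
      by_contra! hμ
      exact h ⟨_, _, _, _, fun h' => hne (IsCategoryOfPaths.right_cancel _ _ _ h'), hμ⟩
    rw [cat_comp, cat_comp] at hμ
    refine ⟨cat α (cat γ₀.2 μ), tail_subset_tail hx ?_, ?_⟩
    · rw [← cat_comp]
      exact cat_mem_tail _ _
    · rintro _ α' β' z ha hb - hz hmem
      obtain ⟨rfl, ha⟩ := Sigma.mk.inj_iff.1 ha
      obtain rfl := eq_of_heq ha
      obtain rfl := eq_of_heq (Sigma.mk.inj_iff.1 hb).2
      -- Cancelling `α` puts `γ₀μΛ` in `z`; hence `βγ₀μΛ` lies in `βz = αz`, together with `αγ₀μΛ`,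
      -- and the two would meet.
      refine hμ (Spec.meets_of_mem _ hmem ?_)
      rw [hz]
      refine tail_mem_concat β ?_
      rwa [mem_concat _ _ (tail_mem_ring _), tail_cat,
        Set.preimage_image_eq _ (cat_injective α)] at hmem
  -- Here `γ` itself works: `αΛ` always belongs to `αz` and is disjoint from `γΛ`.
  · refine ⟨γ, mem_tail_self γ, ?_⟩
    rintro _ α' β' z ha hb - hz hmem
    obtain ⟨rfl, ha⟩ := Sigma.mk.inj_iff.1 ha
    obtain rfl := eq_of_heq ha
    refine hm (Spec.meets_of_mem _ hmem ⟨tail_mem_ring _, Set.univ, ?_, by simp [tail]⟩)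
    obtain ⟨E, hE⟩ := z.maximal.1.nonempty
    exact z.maximal.1.mem_of_superset E hE _ (univ_mem_ring _) (Set.subset_univ _)

/-- Over each path there is a boundary point at which no two distinct paths agree. -/
theorem IsAperiodic.exists_maximal [IsCategoryOfPaths V] [Countable (Σ t v : V, (t ⟶ v))]
    (h : IsAperiodic V) {v : V} (γ : VPath v) : ∃ (D : Set (VPath v)) (hD : Maximal IsDirectedSet D), γ ∈ D ∧
      ∀ {u : V} {α β : u ⟶ v} {z : Spec u},
        concat α z = ofDirected D (nonempty_of_maximal hD) hD.1 →
        concat β z = ofDirected D (nonempty_of_maximal hD) hD.1 → α = β := by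
  have : Countable (VPath v) := by
    refine Function.Injective.countable
      (f := fun x : VPath v => (⟨x.1, v, x.2⟩ : Σ t v : V, (t ⟶ v))) ?_
    rintro ⟨t, x⟩ ⟨t', x'⟩ hx
    obtain ⟨rfl, hx⟩ := Sigma.mk.inj_iff.1 hx
    exact congrArg (Sigma.mk t) (eq_of_heq (Sigma.mk.inj_iff.1 (eq_of_heq hx)).2)
  have : Nonempty (VPath v × VPath v) := ⟨(γ, γ)⟩
  obtain ⟨e, he⟩ := exists_surjective_nat (VPath v × VPath v)
  choose next hnext hkill using fun γ n => h.exists_mem_tail γ (e n).1 (e n).2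
  -- `g (n + 1)` excludes the pair `e n`. Visiting each pair once is enough, as the tail of `g (n +
  -- 1)` stays in the ultrafilter of any directed set containing the sequence.
  let g : ℕ → VPath v := fun n => Nat.rec γ (fun n γ => next γ n) n
  have hg : Antitone fun n => tail (g n) :=
    antitone_nat_of_succ_le fun n => tail_subset_tail (hnext (g n) n)
  obtain ⟨D, hgD, hD⟩ := exists_maximal_directed (C := Set.range g) (by
    rintro _ ⟨m, rfl⟩ _ ⟨n, rfl⟩
    exact ⟨g (max m n), ⟨hg (le_max_left m n) (mem_tail_self _),
      hg (le_max_right m n) (mem_tail_self _)⟩, _, rfl⟩)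
  refine ⟨D, hD, hgD ⟨0, rfl⟩, fun {u α β z} hα hβ => ?_⟩
  by_contra hne
  obtain ⟨n, hn⟩ := he (⟨u, α⟩, ⟨u, β⟩)
  refine hkill (g n) n (congrArg Prod.fst hn) (congrArg Prod.snd hn) hne (hα.trans hβ.symm) ?_
  rw [hα]
  exact ⟨tail_mem_ring _, g (n + 1), hgD ⟨n + 1, rfl⟩, Set.inter_subset_right⟩

end Paths

/-! ### Maximal directed sets under finite alignment -/

section FinitelyAligned

variable {V : Type u} [Category.{w} V] [FinitelyAligned V]

/-- If `ε` met every element of `C`, the sets `εΛ ∩ δΛ` with `δ ∈ C` would lie in an ultrafilter of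
subsets of `vΛ`. The paths whose tails belong to it form a directed set containing `C` and `ε`,
against maximality. -/
theorem exists_not_meets_of_notMem {v : V} {C : Set (VPath v)} (hC : Maximal IsDirectedSet C)
    {ε : VPath v} (hε : ε ∉ C) : ∃ δ ∈ C, ¬ Meets ε δ := by
  by_contra! h
  have hne : Nonempty C := (nonempty_of_maximal hC).to_subtype
  have : (⨅ δ : C, Filter.principal (tail ε ∩ tail δ.1)).NeBot := by
    refine Filter.iInf_neBot_of_directed' ?_ fun δ => Filter.principal_neBot_iff.2 (h δ δ.2)
    rintro ⟨δ, hδ⟩ ⟨δ', hδ'⟩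
    obtain ⟨γ, ⟨h1, h2⟩, h3⟩ := hC.1 δ hδ δ' hδ'
    exact ⟨⟨γ, h3⟩,
      Filter.principal_mono.2 (Set.inter_subset_inter_right _ (tail_subset_tail h1)),
      Filter.principal_mono.2 (Set.inter_subset_inter_right _ (tail_subset_tail h2))⟩
  set 𝒰 := Ultrafilter.of (⨅ δ : C, Filter.principal (tail ε ∩ tail δ.1))
  have hmem : ∀ δ ∈ C, tail ε ∩ tail δ ∈ 𝒰 := fun δ hδ =>
    Ultrafilter.of_le _ (Filter.mem_iInf_of_mem ⟨δ, hδ⟩ (Filter.mem_principal_self _))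
  have hD : IsDirectedSet {δ : VPath v | tail δ ∈ 𝒰} := by
    intro α hα β hβ
    obtain ⟨G, hG⟩ := FinitelyAligned.exists_finset (V := V) α β
    -- `αΛ ∩ βΛ` is a finite union of tails, so the ultrafilter picks one of them; this gives the
    -- common extension.
    have h1 : (⋃ η ∈ (G : Set (VPath v)), tail η) ∈ 𝒰 := by
      have := Filter.inter_mem hα hβ
      rw [hG] at this
      exact this
    obtain ⟨η, hη, h2⟩ := (Ultrafilter.finite_biUnion_mem_iff G.finite_toSet).1 h1
    refine ⟨η, ?_, h2⟩
    rw [hG]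
    exact Set.mem_biUnion hη (mem_tail_self η)
  obtain ⟨δ, hδ⟩ := nonempty_of_maximal hC
  exact hε (hC.2 hD (fun δ hδ => Filter.mem_of_superset (hmem δ hδ) Set.inter_subset_right)
    (Filter.mem_of_superset (hmem δ hδ) Set.inter_subset_left))

theorem exists_disjoint_tail {v : V} {C : Set (VPath v)} (hC : Maximal IsDirectedSet C)
    {G : Set (VPath v)} (hG : G.Finite) (h : Disjoint G C) :
    ∃ δ ∈ C, Disjoint (tail δ) (⋃ ε ∈ G, tail ε) := by
  induction G, hG using Set.Finite.induction_on with
  | empty =>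
    obtain ⟨δ, hδ⟩ := nonempty_of_maximal hC
    exact ⟨δ, hδ, by simp⟩
  | @insert ε G _ _ ih =>
    rw [Set.disjoint_insert_left] at h
    obtain ⟨δ, hδ, h1⟩ := ih h.2
    obtain ⟨δ', hδ', h2⟩ := exists_not_meets_of_notMem hC h.1
    obtain ⟨γ, ⟨h3, h4⟩, h5⟩ := hC.1 δ hδ δ' hδ'
    refine ⟨γ, h5, ?_⟩
    rw [Set.biUnion_insert, Set.disjoint_union_right]
    refine ⟨?_, h1.mono_left (tail_subset_tail h3)⟩
    rw [Set.disjoint_left]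
    exact fun x hx hx' => h2 ⟨x, hx', tail_subset_tail h4 hx⟩

/-! ### Zigzag sets as finite unions of tails -/

/-- The sets that are finite unions of tails. -/
def IsFiniteUnionOfTails {v : V} (E : Set (VPath v)) : Prop :=
  ∃ G : Set (VPath v), G.Finite ∧ E = ⋃ ε ∈ G, tail ε

variable [IsCategoryOfPaths V]

/-- The preimage only sees `βΛ ∩ δΛ`, a finite union of tails of paths `βη`; left cancellation
removes `β`. -/
theorem isFiniteUnionOfTails_preimage_tail {u v : V} (β : u ⟶ v) (δ : VPath v) :
    IsFiniteUnionOfTails (cat β ⁻¹' tail δ) := by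
  obtain ⟨G, hG⟩ := FinitelyAligned.exists_finset (V := V) ⟨u, β⟩ δ
  refine ⟨cat β ⁻¹' G, G.finite_toSet.preimage (cat_injective β).injOn, ?_⟩
  ext x
  have hx : x ∈ cat β ⁻¹' tail δ ↔ cat β x ∈ ⋃ ε ∈ G, tail ε := by
    rw [← hG]
    exact ⟨fun h => ⟨cat_mem_tail β x, h⟩, fun h => h.2⟩
  rw [hx]
  simp only [Set.mem_iUnion, exists_prop, Set.mem_preimage, Finset.mem_coe]
  constructor
  · rintro ⟨ε, hε, h⟩
    have : ε ∈ tail ⟨u, β⟩ ∩ tail δ := hG ▸ Set.mem_biUnion hε (mem_tail_self ε)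
    obtain ⟨η, rfl⟩ := this.1
    refine ⟨η, hε, ?_⟩
    change cat β x ∈ tail (cat β η) at h
    rwa [tail_cat, (cat_injective β).mem_set_image] at h
  · rintro ⟨η, hη, h⟩
    exact ⟨_, hη, by rwa [tail_cat, (cat_injective β).mem_set_image]⟩

/-- Preimages of arbitrary tails, not only domains, are needed for the induction: a longer zigzag
pulls `δΛ` back to finitely many tails, which the shorter zigzag must pull back in turn. -/
theorem Zigzag.isFiniteUnionOfTails_preimage_tail {u v : V} (ζ : Zigzag u v) (δ : VPath v) :
    IsFiniteUnionOfTails {x | ∃ y ∈ tail δ, ζ.graph x y} := by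
  induction ζ with
  | single α β =>
    convert PathCat.isFiniteUnionOfTails_preimage_tail β (cat α δ) using 1
    ext x
    simp only [tail_cat, Zigzag.graph, Set.mem_preimage, Set.mem_image, Set.mem_ofPred_eq]
    simp only [eq_comm]
  | cons α β ζ ih =>
    obtain ⟨G, hG, h⟩ := PathCat.isFiniteUnionOfTails_preimage_tail β (cat α δ)
    choose H hH h' using ih
    refine ⟨⋃ ε ∈ G, H ε, hG.biUnion fun ε _ => hH ε, ?_⟩
    rw [Set.biUnion_iUnion]
    simp only [Set.biUnion_iUnion, ← h']
    ext x
    have key : ∀ z, (∃ ε ∈ G, z ∈ tail ε) ↔ ∃ y ∈ tail δ, cat β z = cat α y := by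
      intro z
      have : z ∈ cat β ⁻¹' tail (cat α δ) ↔ z ∈ ⋃ ε ∈ G, tail ε := by rw [h]
      simp only [Set.mem_iUnion, exists_prop, Set.mem_preimage, tail_cat, Set.mem_image] at this
      rw [← this]
      simp only [eq_comm]
    simp only [Zigzag.graph, Set.mem_iUnion, exists_prop, Set.mem_ofPred_eq]
    constructor
    · rintro ⟨y, hy, z, hz, hyz⟩
      obtain ⟨ε, hε, hz'⟩ := (key z).2 ⟨y, hy, hyz⟩
      exact ⟨ε, hε, z, hz', hz⟩
    · rintro ⟨ε, hε, z, hz', hz⟩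
      obtain ⟨y, hy, hyz⟩ := (key z).1 ⟨ε, hε, hz'⟩
      exact ⟨y, hy, z, hz, hyz⟩

theorem Zigzag.isFiniteUnionOfTails_dom {u v : V} (ζ : Zigzag u v) :
    IsFiniteUnionOfTails ζ.dom := by
  convert ζ.isFiniteUnionOfTails_preimage_tail ⟨v, 𝟙 v⟩ using 1
  ext x
  exact ⟨fun ⟨y, hy⟩ => ⟨y, ⟨y, cat_id y⟩, hy⟩, fun ⟨y, _, hy⟩ => ⟨y, hy⟩⟩

/-! ### Ultrafilters of maximal directed sets and whole tails -/

/-- This sharpens `directedFilter_dichotomy` from `C ∩ γΛ` to `γΛ`. The essential case is a zigzag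
set that misses `C`: it is a finite union of tails of paths outside `C`, and some element of `C`
meets none of these. -/
theorem exists_tail_subset_or_disjoint {v : V} {C : Set (VPath v)}
    (hC : Maximal IsDirectedSet C) {E : Set (VPath v)} (hE : E ∈ ring v) :
    (∃ γ ∈ C, tail γ ⊆ E) ∨ ∃ γ ∈ C, Disjoint (tail γ) E := by
  refine ring_induction (P := fun E => (∃ γ ∈ C, tail γ ⊆ E) ∨ ∃ γ ∈ C, Disjoint (tail γ) E)
    ?_ ?_ ?_ ?_ hE
  · obtain ⟨α, hα⟩ := nonempty_of_maximal hC
    exact Or.inr ⟨α, hα, by simp⟩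
  · rintro s t (⟨γ, hγ, hs⟩ | ⟨γ, hγ, hs⟩) ht
    · exact Or.inl ⟨γ, hγ, hs.trans Set.subset_union_left⟩
    rcases ht with ⟨γ', hγ', ht⟩ | ⟨γ', hγ', ht⟩
    · exact Or.inl ⟨γ', hγ', ht.trans Set.subset_union_right⟩
    · obtain ⟨η, ⟨h1, h2⟩, h3⟩ := hC.1 γ hγ γ' hγ'
      exact Or.inr ⟨η, h3, Set.disjoint_union_right.2
        ⟨hs.mono_left (tail_subset_tail h1), ht.mono_left (tail_subset_tail h2)⟩⟩
  · rintro s t (⟨γ, hγ, hs⟩ | ⟨γ, hγ, hs⟩) ht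
    · rcases ht with ⟨γ', hγ', ht⟩ | ⟨γ', hγ', ht⟩
      · exact Or.inr ⟨γ', hγ', Set.disjoint_sdiff_right.mono_left ht⟩
      · obtain ⟨η, ⟨h1, h2⟩, h3⟩ := hC.1 γ hγ γ' hγ'
        exact Or.inl ⟨η, h3, Set.subset_sdiff.2
          ⟨(tail_subset_tail h1).trans hs, ht.mono_left (tail_subset_tail h2)⟩⟩
    · exact Or.inr ⟨γ, hγ, hs.mono_right Set.sdiff_subset⟩
  · intro t ζ
    by_cases h : ∃ γ ∈ C, γ ∈ ζ.dom
    · obtain ⟨γ, hγ, h⟩ := h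
      exact Or.inl ⟨γ, hγ, tail_subset_dom ζ h⟩
    · obtain ⟨G, hG, hd⟩ := ζ.isFiniteUnionOfTails_dom
      rw [hd]
      refine Or.inr (exists_disjoint_tail hC hG (Set.disjoint_left.2 fun ε hε hεC => ?_))
      exact h ⟨ε, hεC, hd ▸ Set.mem_biUnion hε (mem_tail_self ε)⟩

theorem exists_tail_subset {v : V} {C : Set (VPath v)} (hC : Maximal IsDirectedSet C)
    {E : Set (VPath v)} (hE : E ∈ directedFilter C) : ∃ γ ∈ C, tail γ ⊆ E := by
  rcases exists_tail_subset_or_disjoint hC hE.1 with h | ⟨γ, hγ, h⟩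
  · exact h
  · obtain ⟨-, α, hα, h'⟩ := hE
    obtain ⟨δ, ⟨h1, h2⟩, h3⟩ := hC.1 α hα γ hγ
    exact absurd (h' ⟨h3, h1⟩) (Set.disjoint_left.1 h h2)

/-! ### The two implications -/

theorem concat_eq_of_forall_meets {u v : V} {α β : u ⟶ v}
    (h : ∀ γ : VPath u, Meets (cat α γ) (cat β γ)) {z : Spec u}
    (hz : (⟨v, concat α z⟩ : UnitSpace V) ∈ closure (maximalPoints V)) :
    concat β z = concat α z := by
  by_contra hne
  obtain ⟨F, hF, hF'⟩ : ∃ F ∈ (concat α z).sets, F ∉ (concat β z).sets := by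
    by_contra! hsub
    refine hne (Spec.ext_ring fun E _ => ⟨fun hE => ?_, hsub E⟩)
    exact (concat α z).maximal.2 (concat β z).maximal.1 hsub hE
  have hFr := (concat α z).maximal.1.subset hF
  obtain ⟨F', hF'', hd⟩ := ((concat β z).dichotomy hFr).resolve_left hF'
  have hFr' := (concat β z).maximal.1.subset hF''
  have h1 := (mem_concat α z hFr).1 hF
  have h2 := (mem_concat β z hFr').1 hF''
  have hE := z.maximal.1.inter_mem _ h1 _ h2
  -- With `E` the set of paths that `α` sends into `F` and `β` into `F'`, the set `αE` belongs to
  -- the boundary point `αz`, hence to some `U_C`, and so contains a tail `αγ₀Λ`.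
  obtain ⟨C, hC, hCE⟩ := exists_maximal_of_mem_closure hz
    (E := cat α '' (cat α ⁻¹' F ∩ cat β ⁻¹' F'))
    ⟨image_mem_ring α (z.maximal.1.subset hE), _, hE, subset_rfl⟩
  obtain ⟨γ, -, hγ⟩ := exists_tail_subset hC hCE
  obtain ⟨γ₀, -, rfl⟩ := hγ (mem_tail_self γ)
  rw [tail_cat, Set.image_subset_image_iff (cat_injective α)] at hγ
  obtain ⟨x, hx, hx'⟩ := h γ₀
  rw [tail_cat] at hx hx'
  obtain ⟨a, ha, rfl⟩ := hx
  obtain ⟨b, hb, hab⟩ := hx'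
  have : cat α a ∈ F ∩ F' := ⟨(hγ ha).1, hab ▸ (hγ hb).2⟩
  simp [hd] at this

theorem isAperiodic_of_topologicallyFree (h : TopologicallyFree (Boundary V)) :
    IsAperiodic V := by
  rintro ⟨u, v, α, β, hne, hmeet⟩
  -- A maximal directed set containing `α` shows that the open set of boundary points containing
  -- `αΛ` is not empty.
  obtain ⟨D, hD, hmax⟩ := exists_maximal_directed
    (isDirectedSet_singleton (⟨u, α⟩ : VPath v))
  let x₀ : Boundary V :=
    ⟨⟨v, ofDirected D (nonempty_of_maximal hmax) hmax.1⟩, subset_closure ⟨v, D, hmax, rfl⟩⟩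
  have hopen : IsOpen (Boundary.pt ⁻¹' (Sigma.mk v '' {y : Spec v | tail ⟨u, α⟩ ∈ y.sets})) :=
    (isOpenMap_sigmaMk _ (isOpen_setOf_mem_sets (tail_mem_ring _))).preimage
      continuous_induced_dom
  obtain ⟨⟨_, hy⟩, ⟨y, hyα, rfl⟩, hiso⟩ := h.inter_open_nonempty _ hopen
    ⟨x₀, ofDirected D (nonempty_of_maximal hmax) hmax.1,
      show tail ⟨u, α⟩ ∈ directedFilter D from
        ⟨tail_mem_ring _, ⟨u, α⟩, hD rfl, Set.inter_subset_right⟩, rfl⟩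
  obtain ⟨z, rfl⟩ := exists_concat_eq α y hyα
  let p : Triple (⟨v, concat α z⟩ : UnitSpace V) ⟨v, concat α z⟩ :=
    ⟨u, α, β, z, rfl, concat_eq_of_forall_meets hmeet hy⟩
  -- Both paths of the unit triple are identities, so equivalence with it yields `αδ = δ' = βδ`.
  obtain ⟨t, δ, δ', q, -, -, h1, h2⟩ : Triple.Rel p (Triple.unit _) :=
    Quotient.exact (hiso (Quotient.mk _ p))
  exact hne (IsCategoryOfPaths.right_cancel δ α β (h1.trans h2.symm))

theorem IsAperiodic.topologicallyFree [Countable (Σ t v : V, (t ⟶ v))] (h : IsAperiodic V) :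
    TopologicallyFree (Boundary V) := by
  refine dense_iff_inter_open.2 fun U hU ⟨⟨⟨v, x⟩, hx⟩, hxU⟩ => ?_
  obtain ⟨W, hW, rfl⟩ := isOpen_induced_iff.1 hU
  obtain ⟨E, hE, hEW⟩ := Spec.exists_mem_sets_subset_of_isOpen
    (hW.preimage (continuous_sigmaMk (i := v))) hxU
  obtain ⟨C, hC, hCE⟩ := exists_maximal_of_mem_closure hx hE
  obtain ⟨γ, -, hγ⟩ := exists_tail_subset hC hCE
  obtain ⟨D, hD, hγD, hfree⟩ := h.exists_maximal γ
  refine ⟨⟨⟨v, ofDirected D (nonempty_of_maximal hD) hD.1⟩, subset_closure ⟨v, D, hD, rfl⟩⟩,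
    hEW _ ⟨hCE.1, γ, hγD, Set.inter_subset_right.trans hγ⟩, fun g => ?_⟩
  induction g using Quotient.inductionOn with | _ p
  have hp : p.fst = p.snd := hfree p.concat_fst p.concat_snd
  -- Once the two paths agree, `[α, α, z]` is the unit at `αz`.
  refine Quotient.sound (Triple.rel_of_eq _ _ p.fst p.concat_fst ?_ ?_)
  · exact (Category.comp_id _).symm
  · exact hp.symm.trans (Category.comp_id _).symm

end FinitelyAligned

end PathCat

theorem theoremt {V : Type u} [Category.{w} V] [Countable (Σ t v : V, (t ⟶ v))]
    [PathCat.IsCategoryOfPaths V] [PathCat.FinitelyAligned V] :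
    PathCat.TopologicallyFree (PathCat.Boundary V) ↔ PathCat.IsAperiodic V :=
  ⟨PathCat.isAperiodic_of_topologicallyFree, PathCat.IsAperiodic.topologicallyFree⟩
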